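/- Notation. $M_d$ is the algebra of complex $d\times d$ matrices, $M_m\otimes M_n$ is identified with the $mn\times mn$ matrices by the Kronecker product, and "positive" means positive semidefinite. A matrix $X\in M_m\otimes M_n$ is separable if $X=\sum_{i=1}^N A_i\otimes B_i$ with all $A_i\in M_m$, $B_i\in M_n$ positive. A linear map $\Phi:M_m\to M_n$ is $k$-positive if $\mathrm{id}_k\otimes\Phi$ maps positive matrices in $M_k\otimes M_m$ to positive matrices, and $k$-entanglement breaking ($k$-EB) if it is $k$-positive and $(\mathrm{id}_k\otimes\Phi)(X)$ is separable for every positive $X\in M_k\otimes M_m$. The Choi matrix of $\Phi:M_d\to M_d$ is $C_\Phi=\sum_{i,j=1}^d E_{ij}\otimes\Phi(E_{ij})\in M_d\otimes M_d$, where the $E_{ij}$ are the standard matrix units, and $\mathrm{tr}_1$, $\mathrm{tr}_2$ denote the partial traces over the first and over the second tensor factor. For Hermitian matrices $A$, $B$, possibly of different sizes, $A$ is weakly majorized by $B$ if, after the list of eigenvalues (with multiplicity) of the smaller matrix has been extended by zeros to the length $N$ of the other list, for every $1\le j\le N$ the sum of the $j$ largest entries of the list of $A$ is at most the sum of the $j$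 largest entries of the list of $B$. Theorem. Let $1\le k\le d$ and let $\Phi:M_d\to M_d$ be a $k$-EB linear map. Then $C_\Phi$, $\mathrm{tr}_1(C_\Phi)$ and $\mathrm{tr}_2(C_\Phi)$ are Hermitian, and $C_\Phi$ is weakly majorized by $(d-k+1)\,\mathrm{tr}_1(C_\Phi)$ and by $(d-k+1)\,\mathrm{tr}_2(C_\Phi)$. -/

import Mathlib

open scoped Kronecker ComplexOrder

noncomputable section

namespace KEB

/-- `𝕄 d` is the algebra of complex `d × d` matrices. -/
abbrev 𝕄 (d : ℕ) : Type := Matrix (Fin d) (Fin d) ℂ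

/-- `𝕄₂ m n` is the tensor product of `𝕄 m` and `𝕄 n`, identified as usual (Kronecker product)
with the matrices indexed by `Fin m × Fin n`. -/
abbrev 𝕄₂ (m n : ℕ) : Type := Matrix (Fin m × Fin n) (Fin m × Fin n) ℂ

/-- A matrix `X` in the tensor product of `𝕄 m` and `𝕄 n` is separable if it is a finite sum of
matrices `A i ⊗ B i` with `A i` and `B i` positive semidefinite. -/
def IsSeparable {m n : ℕ} (X : 𝕄₂ m n) : Prop :=
  ∃ (N : ℕ) (A : Fin N → 𝕄 m) (B : Fin N → 𝕄 n),
    (∀ i, (A i).PosSemidef) ∧ (∀ i, (B i).PosSemidef) ∧ X = ∑ i, A i ⊗ₖ B i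

/-- The linear map `id_k ⊗ Φ`: it applies `Φ` to each of the `k × k` blocks of a matrix. -/
def ampliation (k : ℕ) {m n : ℕ} (Φ : 𝕄 m →ₗ[ℂ] 𝕄 n) : 𝕄₂ k m →ₗ[ℂ] 𝕄₂ k n where
  toFun X := Matrix.of fun p q ↦ Φ (Matrix.of fun i j ↦ X (p.1, i) (q.1, j)) p.2 q.2
  map_add' X Y := by
    ext p q
    have h : (Matrix.of fun i j ↦ (X + Y) (p.1, i) (q.1, j) : 𝕄 m)
        = (Matrix.of fun i j ↦ X (p.1, i) (q.1, j)) + Matrix.of fun i j ↦ Y (p.1, i) (q.1, j) := by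
      ext i j; simp
    simp only [Matrix.of_apply, Matrix.add_apply] at h ⊢
    rw [h, map_add, Matrix.add_apply]
  map_smul' c X := by
    ext p q
    have h : (Matrix.of fun i j ↦ (c • X) (p.1, i) (q.1, j) : 𝕄 m)
        = c • (Matrix.of fun i j ↦ X (p.1, i) (q.1, j)) := by
      ext i j; simp
    simp only [Matrix.of_apply, Matrix.smul_apply, RingHom.id_apply] at h ⊢
    rw [h, map_smul, Matrix.smul_apply]

/-- The ampliation is determined by its values on elementary tensors. -/
theorem ampliation_kronecker (k : ℕ) {m n : ℕ} (Φ : 𝕄 m →ₗ[ℂ] 𝕄 n) (A : 𝕄 k) (B : 𝕄 m) :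
    ampliation k Φ (A ⊗ₖ B) = A ⊗ₖ Φ B := by
  ext p q
  have h : (Matrix.of fun i j ↦ (A ⊗ₖ B) (p.1, i) (q.1, j) : 𝕄 m) = A p.1 q.1 • B := by
    ext i j; simp
  change Φ (Matrix.of fun i j ↦ (A ⊗ₖ B) (p.1, i) (q.1, j)) p.2 q.2 = _
  rw [h, map_smul]
  simp

/-- `Φ` is `k`-positive if `id_k ⊗ Φ` maps positive semidefinite matrices to such matrices. -/
def IsKPositive (k : ℕ) {m n : ℕ} (Φ : 𝕄 m →ₗ[ℂ] 𝕄 n) : Prop :=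
  ∀ X : 𝕄₂ k m, X.PosSemidef → (ampliation k Φ X).PosSemidef

/-- `Φ` is `k`-entanglement breaking. -/
def IsKEntanglementBreaking (k : ℕ) {m n : ℕ} (Φ : 𝕄 m →ₗ[ℂ] 𝕄 n) : Prop :=
  IsKPositive k Φ ∧ ∀ X : 𝕄₂ k m, X.PosSemidef → IsSeparable (ampliation k Φ X)

/-- The Choi matrix of `Φ`. -/
def choi {m n : ℕ} (Φ : 𝕄 m →ₗ[ℂ] 𝕄 n) : 𝕄₂ m n :=
  ampliation m Φ (∑ i : Fin m, ∑ j : Fin m, Matrix.single i j 1 ⊗ₖ Matrix.single i j 1)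

/-- Partial trace over the first tensor factor. -/
def partialTrace₁ {m n : ℕ} (X : 𝕄₂ m n) : 𝕄 n :=
  Matrix.of fun i j ↦ ∑ a : Fin m, X (a, i) (a, j)

/-- Partial trace over the second tensor factor. -/
def partialTrace₂ {m n : ℕ} (X : 𝕄₂ m n) : 𝕄 m :=
  Matrix.of fun a b ↦ ∑ i : Fin n, X (a, i) (b, i)

/-- The sum of the `j` largest entries of a finite list of reals, given as a multiset. -/
def topSum (s : Multiset ℝ) (j : ℕ) : ℝ := ((s.sort (· ≥ ·)).take j).sum

/-- Append zeros to `s` until it has at least `N` entries. -/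
def padZero (s : Multiset ℝ) (N : ℕ) : Multiset ℝ := s + Multiset.replicate (N - s.card) 0

/-- Weak majorization of finite lists of reals, as multisets: after appending zeros to the shorter
one, the sum of the `j` largest entries of `x` is at most that of `y`, for each `j` from `1` to
the common length. -/
def WeakMaj (x y : Multiset ℝ) : Prop :=
  ∀ j : ℕ, 1 ≤ j → j ≤ max x.card y.card →
    topSum (padZero x y.card) j ≤ topSum (padZero y x.card) j

/-- The eigenvalues of a Hermitian matrix, with multiplicity. -/
def spec {ι : Type} [Fintype ι] [DecidableEq ι] {A : Matrix ι ι ℂ} (hA : A.IsHermitian) :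
    Multiset ℝ :=
  Finset.univ.val.map hA.eigenvalues

/-- `A` is weakly majorized by `B`: both matrices are Hermitian, and the vector of the eigenvalues
of `A` is weakly majorized by that of `B`. The sizes of `A` and `B` may differ. -/
def WeaklyMajorizedBy {ι κ : Type} [Fintype ι] [DecidableEq ι] [Fintype κ] [DecidableEq κ]
    (A : Matrix ι ι ℂ) (B : Matrix κ κ ℂ) : Prop :=
  ∃ (hA : A.IsHermitian) (hB : B.IsHermitian), WeakMaj (spec hA) (spec hB)

end KEB

end

open scoped Kronecker ComplexOrder

namespace KEB

open Matrix

/-! ### Sums of largest entries -/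

theorem exists_threshold (l : List ℝ) (M : ℝ) (hM : 0 ≤ M) (hl : l.Pairwise (· ≥ ·))
    (h0 : ∀ x ∈ l, 0 ≤ x) (h1 : ∀ x ∈ l, x ≤ M) (j : ℕ) :
    ∃ t, 0 ≤ t ∧ t ≤ M ∧
      (j : ℝ) * t + (l.map fun x ↦ max (x - t) 0).sum ≤ (l.take j).sum := by
  induction l generalizing M j with
  | nil => exact ⟨0, le_rfl, hM, by simp⟩
  | cons x l ih =>
    rw [List.pairwise_cons] at hl
    have hx : 0 ≤ x := h0 x (by simp)
    have hxM : x ≤ M := h1 x (by simp)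
    cases j with
    | zero =>
      refine ⟨x, hx, hxM, ?_⟩
      have : (l.map fun y ↦ max (y - x) 0) = l.map fun _ ↦ (0 : ℝ) := by
        refine List.map_congr_left fun y hy ↦ ?_
        have := hl.1 y hy
        exact max_eq_right (by linarith)
      simp [this]
    | succ j =>
      obtain ⟨t, ht0, htx, h⟩ := ih x hx hl.2 (fun y hy ↦ h0 y (by simp [hy])) hl.1 j
      refine ⟨t, ht0, htx.trans hxM, ?_⟩
      simp only [List.map_cons, List.sum_cons, List.take_succ_cons]
      rw [max_eq_left (by linarith)]
      push_cast
      linarith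

theorem exists_threshold_topSum (s : Multiset ℝ) (h0 : ∀ x ∈ s, 0 ≤ x) (j : ℕ) :
    ∃ t, 0 ≤ t ∧ (j : ℝ) * t + (s.map fun x ↦ max (x - t) 0).sum ≤ topSum s j := by
  have hs : ((s.sort (· ≥ ·) : List ℝ) : Multiset ℝ) = s := Multiset.sort_eq _ _
  obtain ⟨t, ht, -, h⟩ := exists_threshold (s.sort (· ≥ ·)) (s.map fun x ↦ |x|).sum
    (Multiset.sum_nonneg (by simp only [Multiset.mem_map]; rintro _ ⟨x, -, rfl⟩; positivity))
    (Multiset.pairwise_sort _ _) (by simpa using h0)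
    (by
      intro x hx
      rw [Multiset.mem_sort] at hx
      refine (le_abs_self x).trans ?_
      refine Multiset.single_le_sum ?_ _ (Multiset.mem_map_of_mem (fun x ↦ |x|) hx)
      simp only [Multiset.mem_map]; rintro _ ⟨x, -, rfl⟩; positivity) j
  refine ⟨t, ht, ?_⟩
  have h2 : (s.map fun x ↦ max (x - t) 0).sum
      = ((s.sort (· ≥ ·)).map fun x ↦ max (x - t) 0).sum := by
    conv_lhs => rw [← hs]
    rw [Multiset.map_coe, Multiset.sum_coe]
  rw [h2]
  exact h

theorem sum_mul_le_topSum {ι : Type} [Fintype ι] (f w : ι → ℝ) (hf : ∀ i, 0 ≤ f i)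
    (hw0 : ∀ i, 0 ≤ w i) (hw1 : ∀ i, w i ≤ 1) (j N : ℕ) (hw : ∑ i, w i ≤ j) :
    ∑ i, w i * f i ≤ topSum (padZero (Finset.univ.val.map f) N) j := by
  obtain ⟨t, ht, h⟩ := exists_threshold_topSum (padZero (Finset.univ.val.map f) N) (by
    intro x hx
    simp only [padZero, Multiset.mem_add, Multiset.mem_map] at hx
    rcases hx with ⟨i, -, rfl⟩ | hx
    · exact hf i
    · exact (Multiset.eq_of_mem_replicate hx).ge) j
  refine le_trans ?_ h
  have hz : max (0 - t) 0 = 0 := max_eq_right (by linarith)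
  simp only [padZero, Multiset.map_add, Multiset.map_replicate, Multiset.sum_add,
    Multiset.map_map, Multiset.sum_replicate, hz, smul_zero, add_zero]
  change _ ≤ _ + ∑ i, max (f i - t) 0
  calc ∑ i, w i * f i ≤ ∑ i, (w i * t + max (f i - t) 0) := by
        refine Finset.sum_le_sum fun i _ ↦ ?_
        have h1 : w i * (f i - t) ≤ w i * max (f i - t) 0 :=
          mul_le_mul_of_nonneg_left (le_max_left _ _) (hw0 i)
        have h2 : w i * max (f i - t) 0 ≤ 1 * max (f i - t) 0 :=
          mul_le_mul_of_nonneg_right (hw1 i) (le_max_right _ _)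
        linarith
    _ = (∑ i, w i) * t + ∑ i, max (f i - t) 0 := by
        rw [Finset.sum_add_distrib, Finset.sum_mul]
    _ ≤ _ := by
        have := mul_le_mul_of_nonneg_right hw ht
        linarith

theorem exists_le_of_le_map {α β : Type*} [DecidableEq β] (f : α → β) (s : Multiset α)
    (t : Multiset β) (h : t ≤ s.map f) : ∃ u ≤ s, u.map f = t := by
  induction s using Multiset.induction generalizing t with
  | empty => exact ⟨0, le_rfl, (Multiset.le_zero.1 h).symm⟩
  | cons a s ih =>
    rw [Multiset.map_cons] at h
    by_cases ha : f a ∈ t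
    · obtain ⟨u, hu, e⟩ := ih (t.erase (f a)) (Multiset.erase_le_iff_le_cons.2 h)
      exact ⟨a ::ₘ u, Multiset.cons_le_cons a hu, by rw [Multiset.map_cons, e, Multiset.cons_erase ha]⟩
    · obtain ⟨u, hu, e⟩ := ih t ((Multiset.le_cons_of_notMem ha).1 h)
      exact ⟨u, hu.trans (Multiset.le_cons_self _ _), e⟩

theorem exists_finset_topSum {ι : Type} [Fintype ι] (f : ι → ℝ) (j : ℕ) :
    ∃ S : Finset ι, S.card ≤ j ∧ topSum (Finset.univ.val.map f) j = ∑ i ∈ S, f i := by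
  have h : (((Finset.univ.val.map f).sort (· ≥ ·)).take j : Multiset ℝ)
      ≤ Finset.univ.val.map f := by
    conv_rhs => rw [← Multiset.sort_eq (Finset.univ.val.map f) (· ≥ ·)]
    exact Multiset.coe_le.2 (List.take_sublist _ _).subperm
  obtain ⟨u, hu, e⟩ := exists_le_of_le_map f _ _ h
  refine ⟨⟨u, Multiset.nodup_of_le hu Finset.univ.nodup⟩, ?_, ?_⟩
  · have := congrArg Multiset.card e
    rw [Multiset.card_map, Multiset.coe_card] at this
    change u.card ≤ j
    rw [this]
    exact List.length_take_le _ _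
  · change _ = (u.map f).sum
    rw [e, topSum, Multiset.sum_coe]

/-! ### Test operators and Ky Fan's principle -/

/-- `0 ≤ W ≤ 1` and the trace of `W` is at most `j`. -/
structure IsTest {ι : Type} [Fintype ι] [DecidableEq ι] (j : ℝ) (W : Matrix ι ι ℂ) : Prop where
  posSemidef : W.PosSemidef
  le_one : (1 - W).PosSemidef
  trace_le : W.trace.re ≤ j

variable {ι κ ν α : Type} [Fintype ι] [DecidableEq ι] [Fintype κ] [DecidableEq κ]
  [Fintype ν] [DecidableEq ν] [Fintype α]

theorem exists_eq_conjTranspose_mul_self {A : Matrix ι ι ℂ} (hA : A.PosSemidef) :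
    ∃ B : Matrix ι ι ℂ, A = Bᴴ * B := by
  open scoped MatrixOrder in
  exact CStarAlgebra.nonneg_iff_eq_star_mul_self.1 hA.nonneg

theorem trace_mul_nonneg {A B : Matrix ι ι ℂ} (hA : A.PosSemidef) (hB : B.PosSemidef) :
    0 ≤ (A * B).trace.re := by
  obtain ⟨C, rfl⟩ := exists_eq_conjTranspose_mul_self hB
  rw [← Matrix.mul_assoc, Matrix.trace_mul_comm, ← Matrix.mul_assoc]
  exact (Complex.le_def.1 (hA.mul_mul_conjTranspose_same C).trace_nonneg).1

theorem exists_diagonalization {A : Matrix ι ι ℂ} (hA : A.IsHermitian) :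
    ∃ U : Matrix ι ι ℂ, Uᴴ * U = 1 ∧ U * Uᴴ = 1 ∧
      A = U * diagonal (fun i ↦ (hA.eigenvalues i : ℂ)) * Uᴴ := by
  refine ⟨hA.eigenvectorUnitary, ?_, ?_, ?_⟩
  · exact Unitary.coe_star_mul_self hA.eigenvectorUnitary
  · exact Unitary.coe_mul_star_self hA.eigenvectorUnitary
  · have := hA.spectral_theorem
    rw [Unitary.conjStarAlgAut_apply] at this
    exact this

theorem IsTest.conj {j : ℝ} {W : Matrix ι ι ℂ} (hW : IsTest j W) {Z : Matrix ι κ ℂ}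
    (h1 : (1 - Zᴴ * Z).PosSemidef) (h2 : (1 - Z * Zᴴ).PosSemidef) : IsTest j (Zᴴ * W * Z) where
  posSemidef := hW.1.conjTranspose_mul_mul_same Z
  le_one := by
    have : (1 : Matrix κ κ ℂ) - Zᴴ * W * Z = (1 - Zᴴ * Z) + Zᴴ * (1 - W) * Z := by
      rw [Matrix.mul_sub, Matrix.sub_mul, Matrix.mul_one]; abel
    rw [this]
    exact h1.add (hW.2.conjTranspose_mul_mul_same Z)
  trace_le := by
    refine le_trans ?_ hW.3
    have h : (Zᴴ * W * Z).trace = W.trace - (W * (1 - Z * Zᴴ)).trace := by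
      rw [Matrix.mul_sub, Matrix.trace_sub, Matrix.mul_one, Matrix.trace_mul_cycle,
        Matrix.trace_mul_comm, ← Matrix.mul_assoc]
      simp
    rw [h, Complex.sub_re]
    linarith [trace_mul_nonneg hW.1 h2]

theorem IsTest.trace_mul_le_topSum {j N : ℕ} {W B : Matrix ι ι ℂ} (hW : IsTest (j : ℝ) W)
    (hB : B.PosSemidef) (hH : B.IsHermitian) :
    (W * B).trace.re ≤ topSum (padZero (spec hH) N) j := by
  obtain ⟨U, h1, h2, e⟩ := exists_diagonalization hH
  have hV : IsTest (j : ℝ) (Uᴴ * W * U) := hW.conj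
    (by rw [h1, sub_self]; exact .zero) (by rw [h2, sub_self]; exact .zero)
  have key : (W * B).trace = ∑ i, (Uᴴ * W * U) i i * (hH.eigenvalues i : ℂ) := by
    conv_lhs => rw [e]
    rw [← Matrix.mul_assoc, Matrix.trace_mul_comm, ← Matrix.mul_assoc, ← Matrix.mul_assoc]
    simp [Matrix.trace, Matrix.mul_diagonal]
  rw [key, Complex.re_sum]
  simp only [Complex.re_mul_ofReal]
  refine sum_mul_le_topSum _ (fun i ↦ ((Uᴴ * W * U) i i).re) (fun i ↦ ?_) (fun i ↦ ?_)
    (fun i ↦ ?_) j N ?_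
  · exact hB.eigenvalues_nonneg i
  · exact (Complex.le_def.1 hV.1.diag_nonneg).1
  · have := (Complex.le_def.1 (hV.2.diag_nonneg (i := i))).1
    simp only [Matrix.sub_apply, Matrix.one_apply_eq, Complex.sub_re, Complex.one_re,
      Complex.zero_re] at this
    linarith
  · rw [← Complex.re_sum]
    exact hV.3

theorem exists_isTest_topSum {C : Matrix ι ι ℂ} (hC : C.IsHermitian) (j : ℕ) :
    ∃ W, IsTest (j : ℝ) W ∧ topSum (spec hC) j = (W * C).trace.re := by
  obtain ⟨S, hS, e⟩ := exists_finset_topSum hC.eigenvalues j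
  obtain ⟨U, h1, h2, eC⟩ := exists_diagonalization hC
  let D : Matrix ι ι ℂ := diagonal fun i ↦ if i ∈ S then 1 else 0
  have hD : IsTest (j : ℝ) D := by
    refine ⟨PosSemidef.diagonal fun i ↦ ?_, ?_, ?_⟩
    · dsimp; split_ifs <;> simp
    · rw [← diagonal_one, diagonal_sub]
      refine PosSemidef.diagonal fun i ↦ ?_
      dsimp; split_ifs <;> simp
    · simpa [D, Matrix.trace_diagonal] using hS
  refine ⟨U * D * Uᴴ, ?_, ?_⟩
  · have := hD.conj (Z := Uᴴ) (by rw [conjTranspose_conjTranspose, h2, sub_self]; exact .zero)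
      (by rw [conjTranspose_conjTranspose, h1, sub_self]; exact .zero)
    rwa [conjTranspose_conjTranspose] at this
  · have h : U * D * Uᴴ * C = U * (D * diagonal fun i ↦ (hC.eigenvalues i : ℂ)) * Uᴴ := by
      conv_lhs => rw [eC]
      simp only [Matrix.mul_assoc]
      rw [← Matrix.mul_assoc Uᴴ U, h1, Matrix.one_mul]
    rw [h, Matrix.trace_mul_comm, ← Matrix.mul_assoc, h1, Matrix.one_mul, spec, e]
    simp [D, Matrix.trace_diagonal]

/-! ### Gram matrices -/

theorem exists_partial_inverse_sqrt {P : Matrix ι ι ℂ} (hP : P.PosSemidef) :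
    ∃ Q : Matrix ι ι ℂ, Qᴴ = Q ∧ Q * (P * P) * Q = P ∧ (1 - Q * P * Q).PosSemidef ∧
      Q * P * Q * Q = Q := by
  obtain ⟨U, h1, h2, e⟩ := exists_diagonalization hP.1
  have h0 := hP.eigenvalues_nonneg
  set f := hP.1.eigenvalues with hf
  let q : ι → ℂ := fun i ↦ ((√(f i))⁻¹ : ℝ)
  have hqq : ∀ i, q i * f i * q i = if f i = 0 then 0 else 1 := by
    intro i
    simp only [q]
    split_ifs with h
    · simp [h]
    · norm_cast
      have : √(f i) ≠ 0 := by rwa [Ne, Real.sqrt_eq_zero (h0 i)]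
      nth_rewrite 2 [← Real.mul_self_sqrt (h0 i)]
      field_simp
  have hmul : ∀ a b : ι → ℂ, U * diagonal a * Uᴴ * (U * diagonal b * Uᴴ)
      = U * diagonal (fun i ↦ a i * b i) * Uᴴ := by
    intro a b
    rw [← diagonal_mul_diagonal]
    simp only [Matrix.mul_assoc]
    rw [← Matrix.mul_assoc Uᴴ U, h1, Matrix.one_mul]
  refine ⟨U * diagonal q * Uᴴ, ?_, ?_, ?_, ?_⟩
  · simp only [conjTranspose_mul, conjTranspose_conjTranspose, diagonal_conjTranspose,
      Matrix.mul_assoc]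
    congr 3
    ext i
    simp [q]
  · rw [e]
    simp only [hmul]
    congr 3
    ext i
    have := hqq i
    rw [show q i * (f i * f i) * q i = (q i * f i * q i) * f i by ring, this]
    split_ifs with h <;> simp [h]
  · rw [e]
    simp only [hmul]
    have : (1 : Matrix ι ι ℂ) = U * diagonal (fun _ ↦ 1) * Uᴴ := by
      rw [diagonal_one, Matrix.mul_one, h2]
    rw [this, ← Matrix.sub_mul, ← Matrix.mul_sub, diagonal_sub]
    refine (PosSemidef.diagonal fun i ↦ ?_).mul_mul_conjTranspose_same U
    simp only [hqq]
    dsimp; split_ifs <;> simp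
  · rw [e]
    simp only [hmul]
    congr 3
    ext i
    rw [hqq i]
    split_ifs with h <;> simp [q, h]

theorem IsTest.exists_trace_gram_eq {j : ℝ} {W : Matrix ι ι ℂ} (hW : IsTest j W)
    (T : Matrix ι ν ℂ) :
    ∃ W' : Matrix ν ν ℂ, IsTest j W' ∧ (W' * (Tᴴ * T)).trace = (W * (T * Tᴴ)).trace := by
  obtain ⟨Q, hQ, h1, h2, h3⟩ :=
    exists_partial_inverse_sqrt (posSemidef_self_mul_conjTranspose T)
  have hZ : (Q * T)ᴴ = Tᴴ * Q := by rw [conjTranspose_mul, hQ]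
  refine ⟨(Q * T)ᴴ * W * (Q * T), hW.conj ?_ ?_, ?_⟩
  · have hid : (Tᴴ * Q * (Q * T)) * (Tᴴ * Q * (Q * T)) = Tᴴ * Q * (Q * T) := by
      have : (Tᴴ * Q * (Q * T)) * (Tᴴ * Q * (Q * T))
          = Tᴴ * Q * (Q * (T * Tᴴ) * Q * Q) * T := by simp only [Matrix.mul_assoc]
      rw [this, h3]
      simp only [Matrix.mul_assoc]
    have hH : (1 - Tᴴ * Q * (Q * T))ᴴ = 1 - Tᴴ * Q * (Q * T) := by
      simp [conjTranspose_mul, hQ, Matrix.mul_assoc]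
    have : 1 - Tᴴ * Q * (Q * T) = (1 - Tᴴ * Q * (Q * T))ᴴ * (1 - Tᴴ * Q * (Q * T)) := by
      rw [hH, Matrix.mul_sub, Matrix.sub_mul, Matrix.sub_mul, Matrix.mul_one, Matrix.one_mul,
        Matrix.mul_one, hid, sub_self, sub_zero]
    rw [hZ, this]
    exact posSemidef_conjTranspose_mul_self _
  · rw [hZ]
    simpa only [Matrix.mul_assoc] using h2
  · rw [hZ]
    have e1 : Tᴴ * Q * W * (Q * T) * (Tᴴ * T) = (Tᴴ * Q) * (W * Q * T * Tᴴ * T) := by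
      simp only [Matrix.mul_assoc]
    rw [e1, Matrix.trace_mul_comm]
    have e2 : W * Q * T * Tᴴ * T * (Tᴴ * Q) = W * (Q * (T * Tᴴ * (T * Tᴴ)) * Q) := by
      simp only [Matrix.mul_assoc]
    rw [e2, h1]

theorem gram_mul_diagonal (a : Matrix α ν ℂ) (x : ν → ℝ) (i l : ν) :
    ((a * diagonal fun i ↦ (x i : ℂ))ᴴ * (a * diagonal fun i ↦ (x i : ℂ))) i l
      = x i * (aᴴ * a) i l * x l := by
  rw [conjTranspose_mul, diagonal_conjTranspose, Matrix.mul_assoc, ← Matrix.mul_assoc aᴴ,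
    diagonal_mul, mul_diagonal]
  simp [mul_assoc]

/-- If the Gram matrix of `T` is the entrywise product of those of `a` and `b`, then `T * Tᴴ` is
majorized by the sum of `‖a i‖ ^ 2` times the rank one matrices of the columns of `b`. -/
theorem IsTest.exists_trace_hadamard_le {j : ℝ} {W : Matrix ι ι ℂ} (hW : IsTest j W)
    (T : Matrix ι ν ℂ) (a : Matrix α ν ℂ) (b : Matrix κ ν ℂ)
    (h : Tᴴ * T = (aᴴ * a) ⊙ (bᴴ * b)) :
    ∃ W' : Matrix κ κ ℂ, IsTest j W' ∧
      (W * (T * Tᴴ)).trace = (W' * (b * diagonal (fun i ↦ (aᴴ * a) i i) * bᴴ)).trace := by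
  obtain ⟨V, hV, eV⟩ := hW.exists_trace_gram_eq T
  let n : ν → ℝ := fun i ↦ √(∑ x, ‖a x i‖ ^ 2)
  have hn : ∀ i, (aᴴ * a) i i = (n i : ℂ) * n i := by
    intro i
    rw [← Complex.ofReal_mul, Real.mul_self_sqrt (by positivity), Matrix.mul_apply]
    push_cast
    refine Finset.sum_congr rfl fun x _ ↦ ?_
    rw [conjTranspose_apply, Complex.star_def, Complex.conj_mul']
  have ha0 : ∀ i, n i = 0 → ∀ x, a x i = 0 := by
    intro i hi x
    have h1 : ∑ x, ‖a x i‖ ^ 2 = 0 := (Real.sqrt_eq_zero (by positivity)).1 hi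
    have := (Finset.sum_eq_zero_iff_of_nonneg (fun x _ ↦ by positivity)).1 h1 x (Finset.mem_univ x)
    simpa using this
  let K : Matrix α ν ℂ := a * diagonal fun i ↦ (((n i)⁻¹ : ℝ) : ℂ)
  let S : Matrix κ ν ℂ := b * diagonal fun i ↦ (n i : ℂ)
  have hdiag : ∀ i, (Kᴴ * K) i i = if n i = 0 then 0 else 1 := by
    intro i
    have : (Kᴴ * K) i i = (n i : ℂ)⁻¹ * (aᴴ * a) i i * (n i : ℂ)⁻¹ := by
      rw [gram_mul_diagonal, Complex.ofReal_inv]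
    rw [this, hn]
    split_ifs with h0
    · simp [h0]
    · have : (n i : ℂ) ≠ 0 := by exact_mod_cast h0
      field_simp
  have hT : Tᴴ * T = (Kᴴ * K) ⊙ (Sᴴ * S) := by
    rw [h]
    ext i l
    have e1 : (Kᴴ * K) i l = (n i : ℂ)⁻¹ * (aᴴ * a) i l * (n l : ℂ)⁻¹ := by
      rw [gram_mul_diagonal, Complex.ofReal_inv, Complex.ofReal_inv]
    have e2 : (Sᴴ * S) i l = (n i : ℂ) * (bᴴ * b) i l * (n l : ℂ) := gram_mul_diagonal _ _ _ _
    rw [hadamard_apply, hadamard_apply, e1, e2]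
    by_cases hi : n i = 0
    · simp [hi, Matrix.mul_apply, ha0 i hi]
    by_cases hl : n l = 0
    · simp [hl, Matrix.mul_apply, ha0 l hl]
    have hi' : (n i : ℂ) ≠ 0 := by exact_mod_cast hi
    have hl' : (n l : ℂ) ≠ 0 := by exact_mod_cast hl
    field_simp
  have hKT : (Kᴴ * K)ᵀ.PosSemidef := (posSemidef_conjTranspose_mul_self K).transpose
  have hV' : IsTest j (V ⊙ (Kᴴ * K)ᵀ) := by
    refine ⟨hV.1.hadamard hKT, ?_, ?_⟩
    · have : 1 - V ⊙ (Kᴴ * K)ᵀ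
          = diagonal (fun i ↦ if n i = 0 then (1 : ℂ) else 0) + (1 - V) ⊙ (Kᴴ * K)ᵀ := by
        ext i l
        rcases eq_or_ne i l with rfl | hil
        · simp only [Matrix.sub_apply, hadamard_apply, Matrix.add_apply, transpose_apply, hdiag,
            diagonal_apply_eq, one_apply_eq]
          split_ifs <;> ring
        · simp [hil]
      rw [this]
      refine (PosSemidef.diagonal fun i ↦ ?_).add (hV.2.hadamard hKT)
      dsimp; split_ifs <;> simp
    · refine le_trans ?_ hV.3
      rw [Matrix.trace, Matrix.trace, Complex.re_sum, Complex.re_sum]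
      refine Finset.sum_le_sum fun i _ ↦ ?_
      have h0 : 0 ≤ (V i i).re := (Complex.le_def.1 hV.1.diag_nonneg).1
      simp only [diag_apply, hadamard_apply, transpose_apply, hdiag]
      split_ifs <;> simp [h0]
  obtain ⟨W', hW', e⟩ := hV'.exists_trace_gram_eq Sᴴ
  refine ⟨W', hW', ?_⟩
  rw [conjTranspose_conjTranspose] at e
  have hS : S * Sᴴ = b * diagonal (fun i ↦ (aᴴ * a) i i) * bᴴ := by
    simp only [S, conjTranspose_mul, diagonal_conjTranspose]
    rw [Matrix.mul_assoc, ← Matrix.mul_assoc (diagonal _), diagonal_mul_diagonal,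
      ← Matrix.mul_assoc]
    congr 3
    ext i
    rw [hn]
    simp
  rw [← hS, e, ← eV, hT]
  simp only [Matrix.trace, diag_apply, Matrix.mul_apply, hadamard_apply, transpose_apply]
  refine Finset.sum_congr rfl fun i _ ↦ Finset.sum_congr rfl fun l _ ↦ ?_
  ring

/-! ### The cone of separable matrices -/

/-- The convex cone generated by the tensor products of positive semidefinite matrices. -/
def sepCone (m n : ℕ) : AddSubmonoid (𝕄₂ m n) :=
  AddSubmonoid.closure {X | ∃ (A : 𝕄 m) (B : 𝕄 n), A.PosSemidef ∧ B.PosSemidef ∧ X = A ⊗ₖ B}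

theorem kronecker_mem_sepCone {m n : ℕ} {A : 𝕄 m} {B : 𝕄 n} (hA : A.PosSemidef)
    (hB : B.PosSemidef) : A ⊗ₖ B ∈ sepCone m n :=
  AddSubmonoid.subset_closure ⟨A, B, hA, hB, rfl⟩

theorem smul_mem_sepCone {m n : ℕ} {X : 𝕄₂ m n} (hX : X ∈ sepCone m n) {c : ℝ} (hc : 0 ≤ c) :
    c • X ∈ sepCone m n := by
  induction hX using AddSubmonoid.closure_induction with
  | mem X h =>
    obtain ⟨A, B, hA, hB, rfl⟩ := h
    rw [← smul_kronecker]
    exact kronecker_mem_sepCone (hA.smul hc) hB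
  | zero => rw [smul_zero]; exact zero_mem _
  | add X Y _ _ hX hY => rw [smul_add]; exact add_mem hX hY

theorem posSemidef_of_mem_sepCone {m n : ℕ} {X : 𝕄₂ m n} (hX : X ∈ sepCone m n) :
    X.PosSemidef := by
  induction hX using AddSubmonoid.closure_induction with
  | mem X h =>
    obtain ⟨A, B, hA, hB, rfl⟩ := h
    exact hA.kronecker hB
  | zero => exact .zero
  | add X Y _ _ hX hY => exact hX.add hY

theorem conj_kronecker_one_mem_sepCone {k m n : ℕ} {X : 𝕄₂ k n} (hX : IsSeparable X)
    (V : Matrix (Fin m) (Fin k) ℂ) :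
    (V ⊗ₖ (1 : 𝕄 n)) * X * (Vᴴ ⊗ₖ (1 : 𝕄 n)) ∈ sepCone m n := by
  obtain ⟨N, A, B, hA, hB, rfl⟩ := hX
  rw [Matrix.mul_sum, Matrix.sum_mul]
  refine sum_mem fun i _ ↦ ?_
  rw [← mul_kronecker_mul, ← mul_kronecker_mul, Matrix.one_mul, Matrix.mul_one]
  exact kronecker_mem_sepCone ((hA i).mul_mul_conjTranspose_same V) (hB i)

theorem exists_product_vectors {m n : ℕ} {X : 𝕄₂ m n} (hX : X ∈ sepCone m n) :
    ∃ (ν : Type) (_ : Fintype ν) (_ : DecidableEq ν) (a : Matrix (Fin m) ν ℂ)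
      (b : Matrix (Fin n) ν ℂ),
      X = (of fun p i ↦ a p.1 i * b p.2 i) * (of fun p i ↦ a p.1 i * b p.2 i)ᴴ := by
  induction hX using AddSubmonoid.closure_induction with
  | mem X h =>
    obtain ⟨A, B, hA, hB, rfl⟩ := h
    obtain ⟨P, rfl⟩ := exists_eq_conjTranspose_mul_self hA
    obtain ⟨R, rfl⟩ := exists_eq_conjTranspose_mul_self hB
    refine ⟨Fin m × Fin n, inferInstance, inferInstance, of fun p i ↦ Pᴴ p i.1,
      of fun p i ↦ Rᴴ p i.2, ?_⟩
    change _ = (Pᴴ ⊗ₖ Rᴴ) * (Pᴴ ⊗ₖ Rᴴ)ᴴ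
    rw [conjTranspose_kronecker, ← mul_kronecker_mul, conjTranspose_conjTranspose,
      conjTranspose_conjTranspose]
  | zero => exact ⟨Empty, inferInstance, inferInstance, 0, 0, by ext; simp [Matrix.mul_apply]⟩
  | add X Y _ _ hX hY =>
    obtain ⟨ν, _, _, a, b, rfl⟩ := hX
    obtain ⟨μ, _, _, a', b', rfl⟩ := hY
    refine ⟨ν ⊕ μ, inferInstance, inferInstance, of fun p ↦ Sum.elim (a p) (a' p),
      of fun p ↦ Sum.elim (b p) (b' p), ?_⟩
    ext p q
    simp [Matrix.mul_apply]

/-- A separable matrix is majorized by its first partial trace. -/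
theorem IsTest.exists_trace_partialTrace₁ {m n : ℕ} {j : ℝ} {W X : 𝕄₂ m n} (hW : IsTest j W)
    (hX : X ∈ sepCone m n) :
    ∃ W', IsTest j W' ∧ (W * X).trace = (W' * partialTrace₁ X).trace := by
  obtain ⟨ν, _, _, a, b, rfl⟩ := exists_product_vectors hX
  obtain ⟨W', hW', e⟩ := hW.exists_trace_hadamard_le (of fun p i ↦ a p.1 i * b p.2 i) a b (by
    ext i l
    simp [Matrix.mul_apply, Fintype.sum_prod_type, Finset.sum_mul_sum, mul_mul_mul_comm])
  refine ⟨W', hW', e.trans ?_⟩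
  congr 2
  ext p q
  rw [Matrix.mul_apply]
  simp only [mul_diagonal]
  simp only [Matrix.mul_apply, conjTranspose_apply, partialTrace₁, of_apply, Finset.mul_sum,
    Finset.sum_mul]
  rw [Finset.sum_comm]
  refine Finset.sum_congr rfl fun x _ ↦ Finset.sum_congr rfl fun i _ ↦ ?_
  rw [star_mul']
  ring

/-- A separable matrix is majorized by its second partial trace. -/
theorem IsTest.exists_trace_partialTrace₂ {m n : ℕ} {j : ℝ} {W X : 𝕄₂ m n} (hW : IsTest j W)
    (hX : X ∈ sepCone m n) :
    ∃ W', IsTest j W' ∧ (W * X).trace = (W' * partialTrace₂ X).trace := by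
  obtain ⟨ν, _, _, a, b, rfl⟩ := exists_product_vectors hX
  obtain ⟨W', hW', e⟩ := hW.exists_trace_hadamard_le (of fun p i ↦ a p.1 i * b p.2 i) b a (by
    ext i l
    simp only [Matrix.mul_apply, Fintype.sum_prod_type, conjTranspose_apply, of_apply,
      hadamard_apply, Finset.sum_mul_sum]
    rw [Finset.sum_comm]
    refine Finset.sum_congr rfl fun x _ ↦ Finset.sum_congr rfl fun y _ ↦ ?_
    rw [star_mul']
    ring)
  refine ⟨W', hW', e.trans ?_⟩
  congr 2
  ext p q
  rw [Matrix.mul_apply]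
  simp only [mul_diagonal]
  simp only [Matrix.mul_apply, conjTranspose_apply, partialTrace₂, of_apply, Finset.mul_sum,
    Finset.sum_mul]
  rw [Finset.sum_comm]
  refine Finset.sum_congr rfl fun x _ ↦ Finset.sum_congr rfl fun i _ ↦ ?_
  rw [star_mul']
  ring

/-! ### Averages over phases -/

theorem two_pow_add_two_pow_inj {i j k l : ℕ} (h : 2 ^ j + 2 ^ k = 2 ^ i + 2 ^ l) :
    (j = i ∧ k = l) ∨ (j = l ∧ k = i) := by
  have key : ∀ i j k l : ℕ, j ≤ k → i ≤ l → 2 ^ j + 2 ^ k = 2 ^ i + 2 ^ l → l ≤ k := by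
    intro i j k l hjk hil h
    by_contra! hkl
    have h1 : 2 ^ j ≤ 2 ^ k := Nat.pow_le_pow_right (by norm_num) hjk
    have h2 : 2 ^ (k + 1) ≤ 2 ^ l := Nat.pow_le_pow_right (by norm_num) hkl
    have h3 : 0 < 2 ^ i := by positivity
    rw [pow_succ] at h2
    omega
  have main : ∀ i j k l : ℕ, j ≤ k → i ≤ l → 2 ^ j + 2 ^ k = 2 ^ i + 2 ^ l → j = i ∧ k = l := by
    intro i j k l hjk hil h
    obtain rfl : k = l := le_antisymm (key _ _ _ _ hil hjk h.symm) (key _ _ _ _ hjk hil h)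
    exact ⟨Nat.pow_right_injective le_rfl (Nat.add_right_cancel h), rfl⟩
  rcases le_total j k with h1 | h1 <;> rcases le_total i l with h2 | h2
  · exact .inl (main _ _ _ _ h1 h2 h)
  · exact .inr (main _ _ _ _ h1 h2 (h.trans (add_comm _ _)))
  · exact .inr (main _ _ _ _ h1 h2 ((add_comm _ _).trans h)).symm
  · exact .inl (main _ _ _ _ h1 h2 ((add_comm _ _).trans (h.trans (add_comm _ _)))).symm

theorem exists_phases (d : ℕ) :
    ∃ (N : ℕ) (z : Fin N → Fin d → ℂ), 0 < N ∧ ∀ i j k l,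
      ∑ t, star (z t i) * z t j * (z t k * star (z t l))
        = if (j = i ∧ k = l) ∨ (j = l ∧ k = i) then (N : ℂ) else 0 := by
  have hN : 0 < 2 ^ (d + 1) := by positivity
  obtain ⟨ω, hω⟩ : ∃ ω : ℂ, IsPrimitiveRoot ω (2 ^ (d + 1)) :=
    ⟨_, Complex.isPrimitiveRoot_exp _ hN.ne'⟩
  have hstar : ω * star ω = 1 := by
    rw [Complex.star_def, Complex.mul_conj', hω.norm'_eq_one hN.ne']
    simp
  refine ⟨2 ^ (d + 1), fun t i ↦ ω ^ ((t : ℕ) * 2 ^ (i : ℕ)), hN, fun i j k l ↦ ?_⟩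
  let r : ℂ := ω ^ (2 ^ (j : ℕ) + 2 ^ (k : ℕ)) * star ω ^ (2 ^ (i : ℕ) + 2 ^ (l : ℕ))
  have hterm : ∀ t : Fin (2 ^ (d + 1)), star (ω ^ ((t : ℕ) * 2 ^ (i : ℕ))) *
      ω ^ ((t : ℕ) * 2 ^ (j : ℕ)) * (ω ^ ((t : ℕ) * 2 ^ (k : ℕ)) *
      star (ω ^ ((t : ℕ) * 2 ^ (l : ℕ)))) = r ^ (t : ℕ) := by
    intro t
    simp only [r, star_pow, mul_pow, ← pow_mul]
    ring
  simp only [hterm]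
  rw [Fin.sum_univ_eq_sum_range (fun t ↦ r ^ t)]
  have hone : r = 1 ↔ (j = i ∧ k = l) ∨ (j = l ∧ k = i) := by
    constructor
    · intro h
      have h2 : ω ^ (2 ^ (j : ℕ) + 2 ^ (k : ℕ)) = ω ^ (2 ^ (i : ℕ) + 2 ^ (l : ℕ)) := by
        have : r * ω ^ (2 ^ (i : ℕ) + 2 ^ (l : ℕ)) = ω ^ (2 ^ (j : ℕ) + 2 ^ (k : ℕ)) := by
          simp only [r]
          rw [mul_assoc, ← mul_pow, mul_comm (star ω), hstar, one_pow, mul_one]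
        rw [← this, h, one_mul]
      have hlt : ∀ x y : Fin d, 2 ^ (x : ℕ) + 2 ^ (y : ℕ) < 2 ^ (d + 1) := by
        intro x y
        have hx : 2 ^ (x : ℕ) < 2 ^ d := Nat.pow_lt_pow_right (by norm_num) x.2
        have hy : 2 ^ (y : ℕ) < 2 ^ d := Nat.pow_lt_pow_right (by norm_num) y.2
        rw [pow_succ]
        omega
      simpa [Fin.ext_iff] using two_pow_add_two_pow_inj (hω.pow_inj (hlt j k) (hlt i l) h2)
    · rintro (⟨rfl, rfl⟩ | ⟨rfl, rfl⟩)
      · simp only [r, ← mul_pow, hstar, one_pow]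
      · simp only [r, add_comm (2 ^ (k : ℕ)), ← mul_pow, hstar, one_pow]
  split_ifs with h
  · rw [hone.2 h]; simp
  · have hr : r ≠ 1 := fun e ↦ h (hone.1 e)
    have hrN : r ^ 2 ^ (d + 1) = 1 := by
      simp only [r, mul_pow]
      rw [← pow_mul, ← pow_mul, mul_comm _ (2 ^ (d + 1)), mul_comm _ (2 ^ (d + 1)), pow_mul,
        pow_mul, ← star_pow, hω.pow_eq_one]
      simp
    rw [geom_sum_eq hr, hrN]
    simp

/-! ### Choi matrices and their block diagonal companions -/

/-- The block diagonal matrix `∑ i, E i i ⊗ B i`. -/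
def blockSum {d n : ℕ} (B : Fin d → 𝕄 n) : 𝕄₂ d n :=
  ∑ i, single i i 1 ⊗ₖ B i

theorem blockSum_apply {d n : ℕ} (B : Fin d → 𝕄 n) (p q : Fin d × Fin n) :
    blockSum B p q = if p.1 = q.1 then B p.1 p.2 q.2 else 0 := by
  simp only [blockSum, Matrix.sum_apply, kroneckerMap_apply, single_apply]
  rw [Finset.sum_eq_single p.1]
  · simp
  · intro i _ hi
    simp [hi]
  · simp

theorem posSemidef_single {d : ℕ} (i : Fin d) : (single i i (1 : ℂ)).PosSemidef := by
  rw [← diagonal_single]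
  refine PosSemidef.diagonal fun j ↦ ?_
  rcases eq_or_ne j i with rfl | h
  · simp
  · simp [h]

theorem blockSum_mem_sepCone {d n : ℕ} {B : Fin d → 𝕄 n} (hB : ∀ i, (B i).PosSemidef) :
    blockSum B ∈ sepCone d n :=
  sum_mem fun i _ ↦ kronecker_mem_sepCone (posSemidef_single i) (hB i)

theorem choi_apply {m n : ℕ} (Φ : 𝕄 m →ₗ[ℂ] 𝕄 n) (p q : Fin m × Fin n) :
    choi Φ p q = Φ (single p.1 q.1 1) p.2 q.2 := by
  simp only [choi, map_sum, ampliation_kronecker, Matrix.sum_apply, kroneckerMap_apply]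
  rw [Finset.sum_eq_single p.1, Finset.sum_eq_single q.1]
  · simp
  · intro j _ hj
    simp [hj]
  · simp
  · intro i _ hi
    simp [hi]
  · simp

theorem one_eq_sum_single (d : ℕ) : (1 : 𝕄 d) = ∑ i, single i i 1 := by
  ext i j
  rw [Matrix.sum_apply, Finset.sum_eq_single i]
  · simp [one_apply, single_apply]
  · intro a _ ha
    simp [ha]
  · simp

theorem partialTrace₁_choi {m n : ℕ} (Φ : 𝕄 m →ₗ[ℂ] 𝕄 n) : partialTrace₁ (choi Φ) = Φ 1 := by
  rw [one_eq_sum_single, map_sum]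
  ext i j
  simp [partialTrace₁, choi_apply, Matrix.sum_apply]

theorem partialTrace₂_choi_apply {m n : ℕ} (Φ : 𝕄 m →ₗ[ℂ] 𝕄 n) (a b : Fin m) :
    partialTrace₂ (choi Φ) a b = (Φ (single a b 1)).trace := by
  simp [partialTrace₂, choi_apply, Matrix.trace]

theorem posSemidef_map {k m n : ℕ} (hk : 1 ≤ k) {Φ : 𝕄 m →ₗ[ℂ] 𝕄 n} (hΦ : IsKPositive k Φ)
    {A : 𝕄 m} (hA : A.PosSemidef) : (Φ A).PosSemidef := by
  have h := hΦ _ ((posSemidef_single (⟨0, hk⟩ : Fin k)).kronecker hA)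
  rw [ampliation_kronecker] at h
  convert h.submatrix fun i ↦ ((⟨0, hk⟩ : Fin k), i) using 1
  ext i j
  simp

theorem posSemidef_one_sub_single {d : ℕ} (i : Fin d) : (1 - single i i (1 : ℂ)).PosSemidef := by
  rw [← diagonal_single, ← diagonal_one, diagonal_sub]
  refine PosSemidef.diagonal fun j ↦ ?_
  rcases eq_or_ne j i with rfl | h
  · simp
  · simp [h]

theorem posSemidef_partialTrace₂_choi {m n : ℕ} {Φ : 𝕄 m →ₗ[ℂ] 𝕄 n}
    (hΦ : ∀ A : 𝕄 m, A.PosSemidef → (Φ A).PosSemidef) (hC : (choi Φ).IsHermitian) :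
    (partialTrace₂ (choi Φ)).PosSemidef := by
  refine PosSemidef.of_dotProduct_mulVec_nonneg ?_ fun x ↦ ?_
  · ext a b
    simp only [partialTrace₂, conjTranspose_apply, of_apply, star_sum]
    exact Finset.sum_congr rfl fun i _ ↦ hC.apply _ _
  · have h := (hΦ _ (posSemidef_vecMulVec_star_self x)).trace_nonneg
    have e : vecMulVec (star x) x = ∑ a, ∑ b, (star (x a) * x b) • single a b (1 : ℂ) := by
      conv_lhs => rw [matrix_eq_sum_single (vecMulVec (star x) x)]
      simp [vecMulVec_apply]
    rw [e] at h
    simp only [map_sum, map_smul, trace_sum, trace_smul, ← partialTrace₂_choi_apply] at h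
    convert h using 1
    simp only [dotProduct, mulVec, Finset.mul_sum, Pi.star_apply, smul_eq_mul]
    refine Finset.sum_congr rfl fun i _ ↦ Finset.sum_congr rfl fun j _ ↦ ?_
    ring

theorem choi_add_mem_sepCone {d n : ℕ} {Φ : 𝕄 d →ₗ[ℂ] 𝕄 n}
    (hΦ : ∀ A : 𝕄 d, A.PosSemidef → (Φ A).PosSemidef) :
    choi Φ + blockSum (fun i ↦ Φ (1 - single i i 1)) ∈ sepCone d n := by
  obtain ⟨N, z, hN, hz⟩ := exists_phases d
  have key : ∑ t, vecMulVec (star (z t)) (z t) ⊗ₖ vecMulVec (z t) (star (z t))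
      = (N : ℂ) • ((∑ i : Fin d, ∑ j : Fin d, single i j 1 ⊗ₖ single i j 1)
        + blockSum fun i ↦ 1 - single i i 1) := by
    ext ⟨i, k⟩ ⟨j, l⟩
    simp only [Matrix.sum_apply, kroneckerMap_apply, vecMulVec_apply, Pi.star_apply, hz,
      Matrix.smul_apply, Matrix.add_apply, blockSum_apply, smul_eq_mul, Matrix.sub_apply]
    rw [Finset.sum_eq_single i, Finset.sum_eq_single j]
    · simp only [single_apply, one_apply]
      by_cases h1 : i = j <;> by_cases h2 : k = l <;> by_cases h3 : i = k <;>
        by_cases h4 : j = l <;> simp_all [eq_comm]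
    · intro b _ hb
      simp [hb]
    · simp
    · intro a _ ha
      simp [ha]
    · simp
  have h2 := congrArg (ampliation d Φ) key
  rw [map_smul, map_add, map_sum] at h2
  have h3 : ampliation d Φ (blockSum fun i ↦ 1 - single i i 1)
      = blockSum fun i ↦ Φ (1 - single i i 1) := by
    simp only [blockSum, map_sum, ampliation_kronecker]
  rw [h3] at h2
  change _ = (N : ℂ) • (choi Φ + _) at h2
  have h4 : (N : ℂ) • (choi Φ + blockSum fun i ↦ Φ (1 - single i i 1)) ∈ sepCone d n := by
    rw [← h2]
    refine sum_mem fun t _ ↦ ?_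
    rw [ampliation_kronecker]
    exact kronecker_mem_sepCone (posSemidef_vecMulVec_star_self _)
      (hΦ _ (posSemidef_vecMulVec_self_star _))
  have h5 := smul_mem_sepCone h4 (c := (N : ℝ)⁻¹) (by positivity)
  convert h5 using 1
  have hN' : (N : ℂ) ≠ 0 := by exact_mod_cast hN.ne'
  rw [← Complex.coe_smul, smul_smul]
  push_cast
  rw [inv_mul_cancel₀ hN', one_smul]

theorem isHermitian_choi {d n : ℕ} {Φ : 𝕄 d →ₗ[ℂ] 𝕄 n}
    (hΦ : ∀ A : 𝕄 d, A.PosSemidef → (Φ A).PosSemidef) : (choi Φ).IsHermitian := by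
  have h1 := (posSemidef_of_mem_sepCone (choi_add_mem_sepCone hΦ)).1
  have h2 := (posSemidef_of_mem_sepCone (blockSum_mem_sepCone
    fun i ↦ hΦ _ (posSemidef_one_sub_single i))).1
  simpa using h1.sub h2

/-! ### Averages over permutations -/

section Averages

variable {M : Type*} [AddCommMonoid M] {d : ℕ}

theorem sum_perm_apply (f : Fin d → M) (a : Fin d) :
    d • ∑ σ : Equiv.Perm (Fin d), f (σ a) = d.factorial • ∑ b, f b := by
  have h : ∀ b, ∑ σ : Equiv.Perm (Fin d), f (σ b) = ∑ σ : Equiv.Perm (Fin d), f (σ a) := by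
    intro b
    refine Fintype.sum_equiv (Equiv.mulRight (Equiv.swap a b)) _ _ fun σ ↦ ?_
    simp
  calc d • ∑ σ : Equiv.Perm (Fin d), f (σ a)
      = ∑ b, ∑ σ : Equiv.Perm (Fin d), f (σ b) := by simp [h]
    _ = ∑ σ : Equiv.Perm (Fin d), ∑ b, f (σ b) := Finset.sum_comm
    _ = _ := by simp [fun σ : Equiv.Perm (Fin d) ↦ Equiv.sum_comp σ f, Fintype.card_perm]

theorem sum_perm_apply_apply (f : Fin d → Fin d → M) {a b : Fin d} (hab : a ≠ b) :
    (d * (d - 1)) • ∑ σ : Equiv.Perm (Fin d), f (σ a) (σ b)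
      = d.factorial • ∑ i, ∑ j ∈ Finset.univ.erase i, f i j := by
  have h : ∀ a' b', a' ≠ b' → ∑ σ : Equiv.Perm (Fin d), f (σ a') (σ b')
      = ∑ σ : Equiv.Perm (Fin d), f (σ a) (σ b) := by
    intro a' b' hab'
    let x := Equiv.swap a a' b'
    have hx : a ≠ x := by
      intro e
      have := congrArg (Equiv.swap a a') e
      simp only [x, Equiv.swap_apply_left, Equiv.swap_apply_self] at this
      exact hab' this
    refine (Fintype.sum_equiv (Equiv.mulRight (Equiv.swap x b * Equiv.swap a a')) _ _
      fun σ ↦ ?_).symm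
    have h1 : Equiv.swap x b a = a := Equiv.swap_apply_of_ne_of_ne hx hab
    simp [x] at *
    simp [h1]
  calc (d * (d - 1)) • ∑ σ : Equiv.Perm (Fin d), f (σ a) (σ b)
      = ∑ i, ∑ j ∈ Finset.univ.erase i, ∑ σ : Equiv.Perm (Fin d), f (σ i) (σ j) := by
        have : ∀ i : Fin d, ∑ j ∈ Finset.univ.erase i, ∑ σ : Equiv.Perm (Fin d), f (σ i) (σ j)
            = (d - 1) • ∑ σ : Equiv.Perm (Fin d), f (σ a) (σ b) := by
          intro i
          rw [Finset.sum_congr rfl fun j hj ↦ h i j (Finset.ne_of_mem_erase hj).symm]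
          simp
        simp [this, mul_smul]
    _ = ∑ σ : Equiv.Perm (Fin d), ∑ i, ∑ j ∈ Finset.univ.erase i, f (σ i) (σ j) := by
        rw [Finset.sum_comm]
        simp_rw [Finset.sum_comm (s := Finset.univ.erase _)]
    _ = _ := by
        have : ∀ σ : Equiv.Perm (Fin d), ∑ i, ∑ j ∈ Finset.univ.erase i, f (σ i) (σ j)
            = ∑ i, ∑ j ∈ Finset.univ.erase i, f i j := by
          intro σ
          rw [← Equiv.sum_comp σ fun i ↦ ∑ j ∈ Finset.univ.erase i, f i j]
          exact Finset.sum_congr rfl fun i _ ↦ Finset.sum_equiv σ (by simp) (by simp)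
        simp [this, Fintype.card_perm]

end Averages

/-- The block of the Choi matrix of `Φ` at the position `(i, j)`. -/
def choiBlock {d n : ℕ} (Φ : 𝕄 d →ₗ[ℂ] 𝕄 n) (i j : Fin d) : 𝕄₂ d n :=
  single i j 1 ⊗ₖ Φ (single i j 1)

theorem choi_eq_sum_choiBlock {d n : ℕ} (Φ : 𝕄 d →ₗ[ℂ] 𝕄 n) :
    choi Φ = ∑ i, ∑ j, choiBlock Φ i j := by
  simp only [choi, map_sum, ampliation_kronecker, choiBlock]

theorem sum_choiBlock_mem_sepCone {k d n : ℕ} {Φ : 𝕄 d →ₗ[ℂ] 𝕄 n}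
    (hΦ : IsKEntanglementBreaking k Φ) (g : Fin k → Fin d) :
    ∑ a, ∑ b, choiBlock Φ (g a) (g b) ∈ sepCone d n := by
  let v : Fin k × Fin d → ℂ := fun p ↦ if g p.1 = p.2 then 1 else 0
  have hv : vecMulVec v (star v)
      = ∑ a : Fin k, ∑ b : Fin k, single a b (1 : ℂ) ⊗ₖ single (g a) (g b) (1 : ℂ) := by
    ext ⟨a, i⟩ ⟨b, j⟩
    simp only [Matrix.sum_apply, kroneckerMap_apply]
    rw [Finset.sum_eq_single a, Finset.sum_eq_single b]
    · simp only [vecMulVec_apply, v, Pi.star_apply, single_apply]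
      by_cases h1 : g a = i <;> by_cases h2 : g b = j <;> simp [h1, h2]
    · intro b' _ hb
      simp [hb]
    · simp
    · intro a' _ ha
      simp [ha]
    · simp
  have h := hΦ.2 _ (posSemidef_vecMulVec_self_star v)
  rw [hv] at h
  simp only [map_sum, ampliation_kronecker] at h
  let V : Matrix (Fin d) (Fin k) ℂ := of fun i a ↦ if g a = i then 1 else 0
  have hV : ∀ a b, V * single a b (1 : ℂ) * Vᴴ = single (g a) (g b) (1 : ℂ) := by
    intro a b
    ext i j
    rw [Matrix.mul_apply, Finset.sum_eq_single b, mul_single_apply_same]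
    · simp only [V, of_apply, conjTranspose_apply, single_apply]
      by_cases h1 : g a = i <;> by_cases h2 : g b = j <;> simp [h1, h2]
    · intro c _ hc
      rw [mul_single_apply_of_ne _ _ _ _ _ hc, zero_mul]
    · simp
  have h2 := conj_kronecker_one_mem_sepCone h V
  simp only [Matrix.mul_sum, Matrix.sum_mul, ← mul_kronecker_mul, Matrix.one_mul, Matrix.mul_one,
    hV] at h2
  exact h2

theorem choi_add_smul_mem_sepCone {k d n : ℕ} {Φ : 𝕄 d →ₗ[ℂ] 𝕄 n} (hk : 2 ≤ k) (hkd : k ≤ d)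
    (hΦ : IsKEntanglementBreaking k Φ) :
    choi Φ + ((d : ℝ) - k) • blockSum (fun i ↦ Φ (single i i 1)) ∈ sepCone d n := by
  set D := blockSum (fun i ↦ Φ (single i i 1)) with hD
  have hDmem : D ∈ sepCone d n :=
    blockSum_mem_sepCone fun i ↦ posSemidef_map (by omega) hΦ.1 (posSemidef_single i)
  let g : Fin k → Fin d := Fin.castLE hkd
  have hg : Function.Injective g := Fin.castLE_injective hkd
  let S := ∑ σ : Equiv.Perm (Fin d), ∑ a, ∑ b, choiBlock Φ (σ (g a)) (σ (g b))
  have hS : S ∈ sepCone d n :=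
    sum_mem fun σ _ ↦ sum_choiBlock_mem_sepCone hΦ fun a ↦ σ (g a)
  have hdiag : ∀ a, d • ∑ σ : Equiv.Perm (Fin d), choiBlock Φ (σ (g a)) (σ (g a))
      = d.factorial • D := fun a ↦ sum_perm_apply (fun i ↦ choiBlock Φ i i) (g a)
  have hoff : ∀ a b, b ≠ a → (d * (d - 1)) • ∑ σ : Equiv.Perm (Fin d),
      choiBlock Φ (σ (g a)) (σ (g b)) = d.factorial • (choi Φ - D) := by
    intro a b hab
    rw [sum_perm_apply_apply _ (hg.ne hab.symm), choi_eq_sum_choiBlock]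
    congr 1
    rw [eq_sub_iff_add_eq, hD, blockSum, ← Finset.sum_add_distrib]
    exact Finset.sum_congr rfl fun i _ ↦ Finset.sum_erase_add _ _ (Finset.mem_univ i)
  have hSe : (d * (d - 1)) • S
      = (k * ((d - 1) * d.factorial)) • D
        + (k * ((k - 1) * d.factorial)) • (choi Φ - D) := by
    have e : S = ∑ a, ∑ b, ∑ σ : Equiv.Perm (Fin d), choiBlock Φ (σ (g a)) (σ (g b)) := by
      simp only [S]
      rw [Finset.sum_comm]
      exact Finset.sum_congr rfl fun a _ ↦ Finset.sum_comm
    have e2 : ∀ a : Fin k, (d * (d - 1)) •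
        ∑ b, ∑ σ : Equiv.Perm (Fin d), choiBlock Φ (σ (g a)) (σ (g b))
        = ((d - 1) * d.factorial) • D + ((k - 1) * d.factorial) • (choi Φ - D) := by
      intro a
      rw [← Finset.add_sum_erase _ _ (Finset.mem_univ a), smul_add,
        Finset.smul_sum (s := Finset.univ.erase a),
        Finset.sum_congr rfl fun b hb ↦ hoff a b (Finset.ne_of_mem_erase hb), mul_comm d,
        mul_smul, hdiag, ← mul_smul]
      simp [mul_smul]
    rw [e, Finset.smul_sum, Finset.sum_congr rfl fun a _ ↦ e2 a]
    simp [mul_smul]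
  let f : ℝ := d.factorial
  have hf : 0 < f := Nat.cast_pos.2 d.factorial_pos
  have hk' : (2 : ℝ) ≤ k := by exact_mod_cast hk
  have hkd' : (k : ℝ) ≤ d := by exact_mod_cast hkd
  have hSr : ((d : ℝ) * (d - 1)) • S
      = (k * ((d - 1) * f)) • D + (k * ((k - 1) * f)) • (choi Φ - D) := by
    have h1 : ((d - 1 : ℕ) : ℝ) = d - 1 := by rw [Nat.cast_sub (by omega)]; simp
    have h2 : ((k - 1 : ℕ) : ℝ) = k - 1 := by rw [Nat.cast_sub (by omega)]; simp
    rw [← Nat.cast_smul_eq_nsmul ℝ, ← Nat.cast_smul_eq_nsmul ℝ, ← Nat.cast_smul_eq_nsmul ℝ] at hSe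
    simpa only [Nat.cast_mul, h1, h2] using hSe
  have hpos : 0 < (k : ℝ) * ((k - 1) * f) := by
    have : (0 : ℝ) < k - 1 := by linarith
    positivity
  have hcoef : 0 ≤ (k : ℝ) * f * ((k - 2) * (d - k)) :=
    mul_nonneg (by positivity) (mul_nonneg (by linarith) (by linarith))
  have hd1 : 0 ≤ (d : ℝ) * (d - 1) := mul_nonneg (by linarith) (by linarith)
  have hfin : choi Φ + ((d : ℝ) - k) • D = ((k : ℝ) * ((k - 1) * f))⁻¹ •
      (((d : ℝ) * (d - 1)) • S + ((k : ℝ) * f * ((k - 2) * (d - k))) • D) := by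
    rw [eq_inv_smul_iff₀ hpos.ne', hSr]
    module
  rw [hfin]
  exact smul_mem_sepCone (add_mem (smul_mem_sepCone hS hd1) (smul_mem_sepCone hDmem hcoef))
    (by positivity)

/-! ### Weak majorization -/

theorem weaklyMajorizedBy_of_isTest {ι κ : Type} [Fintype ι] [DecidableEq ι] [Fintype κ]
    [DecidableEq κ] {C : Matrix ι ι ℂ} {B : Matrix κ κ ℂ} (hC : C.IsHermitian)
    (hB : B.PosSemidef) (hcard : Fintype.card κ ≤ Fintype.card ι)
    (h : ∀ (j c : ℝ), (∀ V, IsTest j V → (V * B).trace.re ≤ c) →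
      ∀ W, IsTest j W → (W * C).trace.re ≤ c) :
    WeaklyMajorizedBy C B := by
  refine ⟨hC, hB.1, fun j _ _ ↦ ?_⟩
  have hpad : padZero (spec hC) (spec hB.1).card = spec hC := by
    have : (spec hB.1).card - (spec hC).card = 0 := by
      simpa [spec] using Nat.sub_eq_zero_of_le hcard
    rw [padZero, this, Multiset.replicate_zero, add_zero]
  rw [hpad]
  obtain ⟨W, hW, e⟩ := exists_isTest_topSum hC j
  rw [e]
  exact h j _ (fun V hV ↦ hV.trace_mul_le_topSum hB hB.1) W hW

theorem IsTest.diagonal_comp {ι : Type} [Fintype ι] [DecidableEq ι] {j : ℝ} {W : Matrix ι ι ℂ}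
    (hW : IsTest j W) (e : ι ≃ ι) : IsTest j (diagonal fun i ↦ W (e i) (e i)) where
  posSemidef := PosSemidef.diagonal fun _ ↦ hW.1.diag_nonneg
  le_one := by
    rw [← diagonal_one, diagonal_sub]
    refine PosSemidef.diagonal fun i ↦ ?_
    simpa using hW.2.diag_nonneg (i := e i)
  trace_le := by
    rw [trace_diagonal, Equiv.sum_comp e fun i ↦ W i i]
    exact hW.3

theorem IsTest.trace_mul_le_add {ι : Type} [Fintype ι] [DecidableEq ι] {j : ℝ}
    {W C X : Matrix ι ι ℂ} (hW : IsTest j W) (hX : X.PosSemidef) :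
    (W * C).trace.re ≤ (W * (C + X)).trace.re := by
  rw [Matrix.mul_add, trace_add, Complex.add_re]
  linarith [trace_mul_nonneg hW.1 hX]

theorem partialTrace₁_add_blockSum {d n : ℕ} (X : 𝕄₂ d n) (B : Fin d → 𝕄 n) :
    partialTrace₁ (X + blockSum B) = partialTrace₁ X + ∑ i, B i := by
  ext i j
  simp [partialTrace₁, blockSum_apply, Finset.sum_add_distrib, Matrix.sum_apply]

theorem partialTrace₂_add_blockSum {d n : ℕ} (X : 𝕄₂ d n) (B : Fin d → 𝕄 n) :
    partialTrace₂ (X + blockSum B) = partialTrace₂ X + diagonal fun i ↦ (B i).trace := by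
  ext i j
  simp only [partialTrace₂, blockSum_apply, of_apply, Matrix.add_apply, Finset.sum_add_distrib,
    diagonal_apply]
  split_ifs <;> simp [Matrix.trace]

theorem IsTest.trace_mul_add_diagonal_le {ι : Type} [Fintype ι] [DecidableEq ι] {j c : ℝ}
    {W G : Matrix ι ι ℂ} (hW : IsTest j W) (N : ℕ) (e : Fin N → ι ≃ ι)
    (h : ∀ V, IsTest j V → (V * (((N : ℂ) + 1) • G)).trace.re ≤ c) :
    (W * (G + diagonal fun i ↦ ∑ s, G (e s i) (e s i))).trace.re ≤ c := by
  have h' : ∀ V, IsTest j V → ((N : ℝ) + 1) * (V * G).trace.re ≤ c := by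
    intro V hV
    have := h V hV
    rw [Matrix.mul_smul, trace_smul, smul_eq_mul] at this
    have e : ((N : ℂ) + 1) = ((N + 1 : ℝ) : ℂ) := by push_cast; rfl
    rwa [e, Complex.re_ofReal_mul] at this
  have hs : ∀ s, ∑ i, W i i * G (e s i) (e s i)
      = ((diagonal fun i ↦ W ((e s).symm i) ((e s).symm i)) * G).trace := by
    intro s
    rw [← Equiv.sum_comp (e s).symm]
    simp [Matrix.trace, diagonal_mul]
  have hsum : (W * (G + diagonal fun i ↦ ∑ s, G (e s i) (e s i))).trace
      = (W * G).trace
        + ∑ s, ((diagonal fun i ↦ W ((e s).symm i) ((e s).symm i)) * G).trace := by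
    rw [Matrix.mul_add, trace_add]
    congr 1
    rw [Finset.sum_congr rfl fun s _ ↦ (hs s).symm]
    simp only [Matrix.trace, diag_apply, mul_diagonal, Finset.mul_sum]
    exact Finset.sum_comm
  have hN : (0 : ℝ) < N + 1 := by positivity
  have hbound : ∀ V, IsTest j V → (V * G).trace.re ≤ c / (N + 1) := by
    intro V hV
    rw [le_div_iff₀ hN, mul_comm]
    exact h' V hV
  rw [hsum, Complex.add_re, Complex.re_sum]
  calc _ ≤ c / (N + 1) + ∑ _s : Fin N, c / (N + 1) :=
        add_le_add (hbound W hW)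
          (Finset.sum_le_sum fun s _ ↦ hbound _ (hW.diagonal_comp (e s).symm))
    _ = c := by
        simp only [Finset.sum_const, Finset.card_univ, Fintype.card_fin, nsmul_eq_mul]
        field_simp
        ring

theorem choi_weaklyMajorizedBy {d N : ℕ} {Φ : 𝕄 d →ₗ[ℂ] 𝕄 d}
    (hΦ : ∀ A : 𝕄 d, A.PosSemidef → (Φ A).PosSemidef) {B : Fin d → 𝕄 d}
    (hB : ∀ i, (B i).PosSemidef) (hmem : choi Φ + blockSum B ∈ sepCone d d)
    (hsum : ∑ i, B i = (N : ℂ) • Φ 1) (e : Fin N → Equiv.Perm (Fin d))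
    (htr : ∀ i, (B i).trace = ∑ s, (Φ (single (e s i) (e s i) 1)).trace) :
    WeaklyMajorizedBy (choi Φ) (((N : ℂ) + 1) • partialTrace₁ (choi Φ)) ∧
      WeaklyMajorizedBy (choi Φ) (((N : ℂ) + 1) • partialTrace₂ (choi Φ)) := by
  have hC := isHermitian_choi hΦ
  have hX := posSemidef_of_mem_sepCone (blockSum_mem_sepCone hB)
  have hN : (0 : ℂ) ≤ (N : ℂ) + 1 := by positivity
  have hcard : Fintype.card (Fin d) ≤ Fintype.card (Fin d × Fin d) := by
    simpa using Nat.le_mul_self d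
  constructor
  · refine weaklyMajorizedBy_of_isTest hC ?_ hcard fun j c h W hW ↦ ?_
    · rw [partialTrace₁_choi]
      exact (hΦ _ .one).smul hN
    · refine (hW.trace_mul_le_add hX).trans ?_
      obtain ⟨V, hV, eV⟩ := hW.exists_trace_partialTrace₁ hmem
      rw [eV, partialTrace₁_add_blockSum, hsum, partialTrace₁_choi]
      rw [partialTrace₁_choi] at h
      have e1 : Φ 1 + (N : ℂ) • Φ 1 = ((N : ℂ) + 1) • Φ 1 := by module
      rw [e1]
      exact h V hV
  · refine weaklyMajorizedBy_of_isTest hC ((posSemidef_partialTrace₂_choi hΦ hC).smul hN) hcard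
      fun j c h W hW ↦ (hW.trace_mul_le_add hX).trans ?_
    obtain ⟨V, hV, eV⟩ := hW.exists_trace_partialTrace₂ hmem
    rw [eV, partialTrace₂_add_blockSum]
    simp only [htr, ← partialTrace₂_choi_apply]
    exact hV.trace_mul_add_diagonal_le N e h

end KEB

theorem mainTheorem10 (d k : ℕ) (hk : 1 ≤ k) (hkd : k ≤ d) (Φ : KEB.𝕄 d →ₗ[ℂ] KEB.𝕄 d)
    (hΦ : KEB.IsKEntanglementBreaking k Φ) :
    KEB.WeaklyMajorizedBy (KEB.choi Φ)
        (((d : ℂ) - (k : ℂ) + 1) • KEB.partialTrace₁ (KEB.choi Φ)) ∧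
      KEB.WeaklyMajorizedBy (KEB.choi Φ)
        (((d : ℂ) - (k : ℂ) + 1) • KEB.partialTrace₂ (KEB.choi Φ)) := by
  have hpos : ∀ A : KEB.𝕄 d, A.PosSemidef → (Φ A).PosSemidef :=
    fun A hA ↦ KEB.posSemidef_map hk hΦ.1 hA
  have hN : (d : ℂ) - k = ((d - k : ℕ) : ℂ) := by rw [Nat.cast_sub hkd]
  rw [hN]
  rcases hk.eq_or_lt with rfl | hk2
  · obtain ⟨n, rfl⟩ : ∃ n, d = n + 1 := ⟨d - 1, by omega⟩
    refine KEB.choi_weaklyMajorizedBy hpos (fun i ↦ hpos _ (KEB.posSemidef_one_sub_single i))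
      (KEB.choi_add_mem_sepCone hpos) ?_ (fun s ↦ Equiv.addRight (s.succ : Fin (n + 1)))
      fun i ↦ ?_
    · rw [← map_sum, Finset.sum_sub_distrib, ← KEB.one_eq_sum_single, ← map_smul]
      congr 1
      simp [add_smul, ← Nat.cast_smul_eq_nsmul ℂ]
    · rw [map_sub, Matrix.trace_sub, sub_eq_iff_eq_add, KEB.one_eq_sum_single, map_sum,
        Matrix.trace_sum, ← Equiv.sum_comp (Equiv.addLeft i), Fin.sum_univ_succ, add_comm]
      simp
  · refine KEB.choi_weaklyMajorizedBy hpos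
      (B := fun i ↦ ((d : ℝ) - k) • Φ (Matrix.single i i 1))
      (fun i ↦ (hpos _ (KEB.posSemidef_single i)).smul (by simpa using hkd)) ?_ ?_
      (fun _ ↦ Equiv.refl _) fun i ↦ ?_
    · convert KEB.choi_add_smul_mem_sepCone hk2 hkd hΦ using 2
      rw [KEB.blockSum, KEB.blockSum, Finset.smul_sum]
      exact Finset.sum_congr rfl fun i _ ↦ Matrix.kronecker_smul _ _ _
    · rw [← Finset.smul_sum, ← map_sum, ← KEB.one_eq_sum_single, ← Complex.coe_smul, ← hN]
      push_cast
      rfl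
    · rw [Matrix.trace_smul, ← Complex.coe_smul]
      push_cast
      simp [← hN]
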